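/- **Theorem (Holm).** Let $R$ be a commutative artinian ring and let $A$ be an artin $R$-algebra, that is, an associative unital $R$-algebra which is finitely generated as an $R$-module. Then $$\mathrm{Fin.dim}\,A=\mathrm{Fin.GP.dim}\,A\qquad\text{and}\qquad \mathrm{fin.dim}\,A=\mathrm{fin.Gp.dim}\,A .$$ Here modules are left $A$-modules, not necessarily finitely generated unless stated otherwise, and the notation is as follows. * An acyclic complex $P^\bullet=(P^n)_{n\in\mathbb Z}$ of projective modules is *totally acyclic* if $\mathrm{Hom}_A(P^\bullet,Q)$ is acyclic for every projective module $Q$. A module is *Gorenstein-projective* if it is isomorphic to the zeroth cocycle module $Z^0(P^\bullet)$ of a totally acyclic complex $P^\bullet$. * A *proper Gorenstein-projective resolution* of a module $M$ is an acyclic complex $\cdots\to G_2\to G_1\to G_0\to M\to 0$ with every $G_i$ Gorenstein-projective that remains acyclic under $\mathrm{Hom}_A(G,-)$ for every Gorenstein-projective module $G$. With $G_\bullet$ the complex $\cdots\to G_2\to G_1\to G_0$, one puts $\mathrm{Ext}^n_{\mathrm{GP}}(M,N)=H^n(\mathrm{Hom}_A(G_\bullet,N))$ for $n\ge 0$; every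 module over an artin algebra has such a resolution, and these groups do not depend on its choice. * $\mathrm{GP.dim}\,M=\sup\{n\ge 0 \mid \mathrm{Ext}^n_{\mathrm{GP}}(M,N)\neq 0 \text{ for some module } N\}$. * $\mathrm{Fin.GP.dim}\,A$ (resp. $\mathrm{fin.Gp.dim}\,A$) is the supremum of $\mathrm{GP.dim}\,M$ over all modules (resp. all finitely generated modules) $M$ with $\mathrm{GP.dim}\,M<\infty$. * $\mathrm{Fin.dim}\,A$ (resp. $\mathrm{fin.dim}\,A$) is the supremum of the projective dimensions of all modules (resp. all finitely generated modules) of finite projective dimension. All suprema are taken in $\{-\infty\}\cup\mathbb N\cup\{\infty\}$, with $\sup\emptyset=-\infty$; the zero module has dimension $-\infty$. -/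

import Mathlib

universe u v

noncomputable section GorensteinDefs

open CategoryTheory

namespace Gorenstein

/-- The Hom complex `Hom_C(X, N)` of abelian groups, for a complex `X` and an object `N`. -/
def homFromComplex {C : Type u} [Category.{v} C] [Preadditive C] {ι : Type*}
    {c : ComplexShape ι} (X : HomologicalComplex C c) (N : C) :
    HomologicalComplex AddCommGrpCat.{v} c.symm :=
  ((preadditiveYoneda.obj N).mapHomologicalComplex c.symm).obj X.op

/-- The Hom complex `Hom_C(G, X)` of abelian groups, for an object `G` and a complex `X`. -/
def homToComplex {C : Type u} [Category.{v} C] [Preadditive C] {ι : Type*}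
    {c : ComplexShape ι} (G : C) (X : HomologicalComplex C c) :
    HomologicalComplex AddCommGrpCat.{v} c :=
  ((preadditiveCoyoneda.obj (Opposite.op G)).mapHomologicalComplex c).obj X

variable {A : Type v} [Ring A]

/-- A complex `P` of `A`-modules, indexed by `ℤ`, is totally acyclic if its terms are projective,
it is acyclic, and `Hom_A(P, Q)` is acyclic for every projective module `Q`. -/
structure IsTotallyAcyclic (P : CochainComplex (ModuleCat.{v} A) ℤ) : Prop where
  projective : ∀ n : ℤ, Projective (P.X n)
  acyclic : P.Acyclic
  hom_acyclic : ∀ Q : ModuleCat.{v} A, Projective Q → (homFromComplex P Q).Acyclic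

/-- A module, not necessarily finitely generated, is Gorenstein-projective if it is isomorphic
to the zeroth cocycle module of a totally acyclic complex. -/
def IsGorensteinProjective (M : ModuleCat.{v} A) : Prop :=
  ∃ P : CochainComplex (ModuleCat.{v} A) ℤ, IsTotallyAcyclic P ∧ Nonempty (P.cycles 0 ≅ M)

/-- A complex `X` is right GP-acyclic if `Hom_A(G, X)` is acyclic for every
Gorenstein-projective module `G`. -/
def IsRightGPAcyclic {ι : Type*} {c : ComplexShape ι}
    (X : HomologicalComplex (ModuleCat.{v} A) c) : Prop :=
  ∀ G : ModuleCat.{v} A, IsGorensteinProjective G → (homToComplex G X).Acyclic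

/-- A proper Gorenstein-projective resolution `⋯ → G₂ → G₁ → G₀ → M → 0`: the augmented complex
(with `M` in degree `0` and `Gₙ` in degree `n + 1`) is acyclic and right GP-acyclic. -/
structure ProperGPResolution (M : ModuleCat.{v} A) where
  /-- the complex `⋯ → G₂ → G₁ → G₀` -/
  complex : ChainComplex (ModuleCat.{v} A) ℕ
  /-- the augmentation `G₀ → M` -/
  aug : complex.X 0 ⟶ M
  d_aug : complex.d 1 0 ≫ aug = 0
  gorensteinProjective : ∀ n : ℕ, IsGorensteinProjective (complex.X n)
  acyclic : (complex.augment aug d_aug).Acyclic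
  proper : IsRightGPAcyclic (complex.augment aug d_aug)

/-- The `n`-th GP-extension group `Ext_GP^n(M, N) = Hⁿ(Hom_A(G, N))`, computed with a proper
Gorenstein-projective resolution `G` of `M`. -/
def gpExt {M : ModuleCat.{v} A} (G : ProperGPResolution M) (N : ModuleCat.{v} A) (n : ℕ) :
    AddCommGrpCat.{v} :=
  (homFromComplex G.complex N).homology n

/-- The Gorenstein-projective dimension `sup {n | Ext_GP^n(M, -) ≠ 0}`. By the comparison theorem
`Ext_GP` does not depend on the proper resolution. The zero module has dimension `⊥`, as it has
for Mathlib's projective dimension. -/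
def gpDim (M : ModuleCat.{v} A) : WithBot ℕ∞ :=
  sSup {d | ∃ n : ℕ, d = n ∧
    ∃ (G : ProperGPResolution M) (N : ModuleCat.{v} A), Nontrivial (gpExt G N n)}

variable (A)

/-- The large finitistic dimension of `A`. -/
def bigFinDim : WithBot ℕ∞ :=
  ⨆ (M : ModuleCat.{v} A) (_ : projectiveDimension M < ⊤), projectiveDimension M

/-- The small finitistic dimension of `A`. -/
def smallFinDim : WithBot ℕ∞ :=
  ⨆ (M : ModuleCat.{v} A) (_ : Module.Finite A M) (_ : projectiveDimension M < ⊤),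
    projectiveDimension M

/-- The large finitistic Gorenstein-projective dimension of `A`. -/
def bigFinGPDim : WithBot ℕ∞ :=
  ⨆ (M : ModuleCat.{v} A) (_ : gpDim M < ⊤), gpDim M

/-- The small finitistic Gorenstein-projective dimension of `A`. -/
def smallFinGPDim : WithBot ℕ∞ :=
  ⨆ (M : ModuleCat.{v} A) (_ : Module.Finite A M) (_ : gpDim M < ⊤), gpDim M

end Gorenstein

end GorensteinDefs

/-! The argument rests on Auslander–Buchweitz hulls. For a module M with a proper
Gorenstein-projective resolution, GP.dim M ≤ n holds exactly when there is an exact sequence 0 → M →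
L → C → 0 with pd L ≤ n and C Gorenstein-projective (`HasHull.gpDim_le`,
`ProperGPResolution.hasHull`). Hulls travel along 0 → K → G → M → 0 with G Gorenstein-projective: n
drops by one from M to K (`HasHull.syzygy`) and rises by one from K to M (`HasHull.of_syzygy`),
while n = 0 means that the module itself is Gorenstein-projective.

If GP.dim M = n, then pd L = n, since a smaller value would give a smaller bound on GP.dim M. So
every finite GP-dimension is a projective dimension. Conversely, positive Ext groups from
Gorenstein-projective modules to modules of finite projective dimension vanish. Hence, when pd M is
finite, a projective resolution of M is proper and the hull sequence of M splits, which gives GP.dim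
M = pd M. The two suprema therefore agree.

For the small dimensions the hull of a finitely generated M must be finitely generated. This is
where the artin algebra enters: Hom_A(M, A) is finitely generated over R, so all linear forms on M
factor through one map M → A^k (`HasCoresolution.hasHull_finite`, `HasHull.finite`).

Gorenstein-projective modules are handled through the coinductive predicate `HasCoresolution`, which
avoids complexes; the equivalence is obtained by cutting and splicing. -/

namespace Gorenstein

open CategoryTheory Abelian

/-! ### Short exact sequences of modules, pushouts and pullbacks, and dimension shifting -/

section ShortExactSequences

variable {A : Type v} [Ring A]

/-- A pair of linear maps forming a short exact sequence `0 → X → Y → Z → 0`. -/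
structure IsShortExact {X Y Z : Type v} [AddCommGroup X] [AddCommGroup Y] [AddCommGroup Z]
    [Module A X] [Module A Y] [Module A Z] (f : X →ₗ[A] Y) (g : Y →ₗ[A] Z) : Prop where
  inj : Function.Injective f
  exact : Function.Exact f g
  surj : Function.Surjective g

/-- There is a short exact sequence `0 → X → Y → Z → 0`. -/
def SES (X Y Z : ModuleCat.{v} A) : Prop :=
  ∃ (f : X →ₗ[A] Y) (g : Y →ₗ[A] Z), IsShortExact f g

variable {X Y Z W Q C K N : ModuleCat.{v} A}

/-- The short complex in `ModuleCat` attached to a short exact sequence of linear maps. -/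
abbrev IsShortExact.toShortComplex {f : X →ₗ[A] Y} {g : Y →ₗ[A] Z} (h : IsShortExact f g) :
    ShortComplex (ModuleCat.{v} A) :=
  ShortComplex.mk (ModuleCat.ofHom f) (ModuleCat.ofHom g)
    (by ext x; exact h.exact.apply_apply_eq_zero x)

theorem IsShortExact.shortExact {f : X →ₗ[A] Y} {g : Y →ₗ[A] Z} (h : IsShortExact f g) :
    h.toShortComplex.ShortExact :=
  ModuleCat.shortComplex_shortExact _ h.exact h.inj h.surj

theorem isShortExact_mkQ {f : X →ₗ[A] Y} (hf : Function.Injective f) :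
    IsShortExact f (LinearMap.range f).mkQ :=
  ⟨hf, fun y => by simp, Submodule.mkQ_surjective _⟩

theorem isShortExact_ker_subtype {g : Y →ₗ[A] Z} (hg : Function.Surjective g) :
    IsShortExact (LinearMap.ker g).subtype g :=
  ⟨Submodule.injective_subtype _, fun y => by simp, hg⟩

theorem IsShortExact.extend {f : X →ₗ[A] Y} {g : Y →ₗ[A] Z} (h : IsShortExact f g)
    (hN : Subsingleton (Ext Z N 1)) (φ : X →ₗ[A] N) : ∃ ψ : Y →ₗ[A] N, ψ ∘ₗ f = φ := by
  obtain ⟨x, hx⟩ := Ext.contravariant_sequence_exact₁ h.shortExact N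
    (Ext.mk₀ (ModuleCat.ofHom φ)) (n₁ := 1) rfl (Subsingleton.elim _ _)
  obtain ⟨ψ, rfl⟩ := Ext.mk₀_bijective _ _ |>.2 x
  rw [Ext.mk₀_comp_mk₀] at hx
  have := (Ext.mk₀_bijective _ _).1 hx
  exact ⟨ψ.hom, by simpa using congrArg ModuleCat.Hom.hom this⟩

theorem IsShortExact.lift {f : X →ₗ[A] Y} {g : Y →ₗ[A] Z} (h : IsShortExact f g)
    (hN : Subsingleton (Ext N X 1)) (φ : N →ₗ[A] Z) : ∃ ψ : N →ₗ[A] Y, g ∘ₗ ψ = φ := by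
  obtain ⟨x, hx⟩ := Ext.covariant_sequence_exact₃ N h.shortExact
    (Ext.mk₀ (ModuleCat.ofHom φ)) (n₁ := 1) rfl (Subsingleton.elim _ _)
  obtain ⟨ψ, rfl⟩ := Ext.mk₀_bijective _ _ |>.2 x
  rw [Ext.mk₀_comp_mk₀] at hx
  have := (Ext.mk₀_bijective _ _).1 hx
  exact ⟨ψ.hom, by simpa using congrArg ModuleCat.Hom.hom this⟩

/-- A short exact sequence with a retraction is isomorphic to the direct sum. -/
theorem IsShortExact.equiv_prod_of_retraction {f : X →ₗ[A] Y} {g : Y →ₗ[A] Z}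
    (h : IsShortExact f g) {r : Y →ₗ[A] X} (hr : r ∘ₗ f = LinearMap.id) :
    Nonempty (Y ≃ₗ[A] X × Z) := by
  have hrf : ∀ x, r (f x) = x := fun x => LinearMap.congr_fun hr x
  refine ⟨LinearEquiv.ofBijective (r.prod g) ⟨?_, ?_⟩⟩
  · rw [injective_iff_map_eq_zero]
    intro y hy
    have hy₁ : r y = 0 := (Prod.ext_iff.1 hy).1
    have hy₂ : g y = 0 := (Prod.ext_iff.1 hy).2
    obtain ⟨x, rfl⟩ := (h.exact y).1 hy₂
    rw [hrf] at hy₁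
    rw [hy₁, map_zero]
  · rintro ⟨x, z⟩
    obtain ⟨y, rfl⟩ := h.surj z
    refine ⟨y + f (x - r y), ?_⟩
    ext <;> simp [hrf, h.exact.apply_apply_eq_zero]

theorem SES.split (h : SES X Y Z) (hE : Subsingleton (Ext Z X 1)) :
    Nonempty (Y ≃ₗ[A] X × Z) := by
  obtain ⟨f, g, h⟩ := h
  obtain ⟨r, hr⟩ := h.extend hE LinearMap.id
  exact h.equiv_prod_of_retraction hr

theorem SES.congr_left (h : SES X Y Z) (e : W ≃ₗ[A] X) : SES W Y Z := by
  obtain ⟨f, g, h⟩ := h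
  refine ⟨f ∘ₗ e, g, h.inj.comp e.injective, fun y => (h.exact y).trans ?_, h.surj⟩
  exact ⟨fun ⟨x, hx⟩ => ⟨e.symm x, by simpa using hx⟩, fun ⟨x, hx⟩ => ⟨e x, hx⟩⟩

theorem SES.congr_right (h : SES X Y Z) (e : Z ≃ₗ[A] W) : SES X Y W := by
  obtain ⟨f, g, h⟩ := h
  refine ⟨f, e ∘ₗ g, h.inj, fun y => ?_, e.surjective.comp h.surj⟩
  rw [← h.exact y]
  simp

theorem ses_prod (X Y : ModuleCat.{v} A) : SES X (ModuleCat.of A (X × Y)) Y :=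
  ⟨LinearMap.inl A X Y, LinearMap.snd A X Y, LinearMap.inl_injective,
    .inl_snd, LinearMap.snd_surjective⟩

theorem SES.prod_left (h : SES X Y Z) (W : ModuleCat.{v} A) :
    SES (ModuleCat.of A (W × X)) (ModuleCat.of A (W × Y)) Z := by
  obtain ⟨f, g, h⟩ := h
  refine ⟨LinearMap.prodMap LinearMap.id f, g ∘ₗ LinearMap.snd A W Y,
    Function.injective_id.prodMap h.inj, ?_, h.surj.comp LinearMap.snd_surjective⟩
  rintro ⟨w, y⟩
  refine (h.exact y).trans ⟨?_, ?_⟩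
  · rintro ⟨x, rfl⟩
    exact ⟨(w, x), rfl⟩
  · rintro ⟨⟨w', x⟩, hx⟩
    exact ⟨x, (Prod.ext_iff.1 hx).2⟩

/-- For submodules `X ⊆ Y ⊆ Q`, the quotient `Q / X` is an extension of `Q / Y` by `Y / X`. -/
theorem SES.exists_quotient (h₁ : SES X Y Z) (h₂ : SES Y Q C) :
    ∃ L : ModuleCat.{v} A, SES X Q L ∧ SES Z L C := by
  obtain ⟨f, g, h₁⟩ := h₁
  obtain ⟨f', g', h₂⟩ := h₂
  have hfg : ∀ x, g (f x) = 0 := h₁.exact.apply_apply_eq_zero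
  have hfg' : ∀ x, g' (f' x) = 0 := h₂.exact.apply_apply_eq_zero
  have hinj : Function.Injective (f' ∘ₗ f) := h₂.inj.comp h₁.inj
  have hS := isShortExact_mkQ hinj
  let p := (LinearMap.range (f' ∘ₗ f)).mkQ
  have hp : ∀ y, p (f' y) = 0 ↔ g y = 0 := by
    intro y
    rw [h₁.exact y, hS.exact]
    exact ⟨fun ⟨x, hx⟩ => ⟨x, h₂.inj hx⟩, fun ⟨x, hx⟩ => ⟨x, by simp [hx]⟩⟩
  refine ⟨ModuleCat.of A (Q ⧸ LinearMap.range (f' ∘ₗ f)), ⟨_, _, hS⟩, ?_⟩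
  let q : (Q ⧸ LinearMap.range (f' ∘ₗ f)) →ₗ[A] C :=
    (LinearMap.range (f' ∘ₗ f)).liftQ g' (by rintro _ ⟨x, rfl⟩; simp [hfg'])
  let e := g.quotKerEquivOfSurjective h₁.surj
  let i' : (Y ⧸ LinearMap.ker g) →ₗ[A] (Q ⧸ LinearMap.range (f' ∘ₗ f)) :=
    (LinearMap.ker g).liftQ (p ∘ₗ f') (fun y hy => (hp y).2 hy)
  have hi' : ∀ y, i' ((LinearMap.ker g).mkQ y) = p (f' y) := fun y => rfl
  have hq : ∀ x, q (p x) = g' x := fun x => rfl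
  refine (show SES (ModuleCat.of A (Y ⧸ LinearMap.ker g)) _ C from
    ⟨i', q, ?_, ?_, ?_⟩).congr_left (W := Z) e.symm
  · rw [injective_iff_map_eq_zero]
    intro y hy
    obtain ⟨y, rfl⟩ := Submodule.mkQ_surjective _ y
    rw [hi', hp] at hy
    simpa using hy
  · intro x
    obtain ⟨x, rfl⟩ := Submodule.mkQ_surjective _ x
    change q (p x) = 0 ↔ _
    rw [hq, h₂.exact]
    constructor
    · rintro ⟨y, rfl⟩
      exact ⟨(LinearMap.ker g).mkQ y, rfl⟩
    · rintro ⟨y, hy⟩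
      obtain ⟨y, rfl⟩ := Submodule.mkQ_surjective _ y
      rw [hi', ← sub_eq_zero, ← map_sub] at hy
      obtain ⟨w, hw⟩ := (hS.exact _).1 hy
      refine ⟨y - f w, ?_⟩
      rw [map_sub]
      rw [LinearMap.comp_apply] at hw
      rw [hw]; abel
  · intro c
    obtain ⟨x, rfl⟩ := h₂.surj c
    exact ⟨p x, rfl⟩

/-- The preimage of a submodule `M ⊆ L` under a surjection `P → L` with kernel `K`. -/
theorem SES.exists_preimage {P L M : ModuleCat.{v} A} (h₁ : SES K P L) (h₂ : SES M L C) :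
    ∃ G : ModuleCat.{v} A, SES K G M ∧ SES G P C := by
  obtain ⟨f, g, h₁⟩ := h₁
  obtain ⟨f', g', h₂⟩ := h₂
  have hfg : ∀ x, g (f x) = 0 := h₁.exact.apply_apply_eq_zero
  have hsurj : Function.Surjective (g' ∘ₗ g) := h₂.surj.comp h₁.surj
  have hS := isShortExact_ker_subtype hsurj
  refine ⟨ModuleCat.of A (LinearMap.ker (g' ∘ₗ g)), ?_, ⟨_, _, hS⟩⟩
  let e := LinearEquiv.ofInjective f' h₂.inj
  have hr : ∀ x : LinearMap.ker (g' ∘ₗ g), g x ∈ LinearMap.range f' := fun x =>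
    (h₂.exact _).1 x.2
  let p : LinearMap.ker (g' ∘ₗ g) →ₗ[A] LinearMap.range f' :=
    (g ∘ₗ Submodule.subtype _).codRestrict _ hr
  refine (show SES K _ (ModuleCat.of A (LinearMap.range f')) from
    ⟨f.codRestrict _ (fun x => by simp [hfg]), p, ?_, ?_, ?_⟩).congr_right (W := M) e.symm
  · exact fun x y hxy => h₁.inj (congrArg Subtype.val hxy)
  · intro x
    rw [Subtype.ext_iff]
    refine (h₁.exact (x : P)).trans ⟨?_, ?_⟩
    · rintro ⟨k, hk⟩
      exact ⟨k, Subtype.ext hk⟩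
    · rintro ⟨k, hk⟩
      exact ⟨k, congrArg Subtype.val hk⟩
  · rintro ⟨_, m, rfl⟩
    obtain ⟨x, hx⟩ := h₁.surj (f' m)
    refine ⟨⟨x, ?_⟩, Subtype.ext hx⟩
    simp [hx, h₂.exact.apply_apply_eq_zero]

/-- The pushout of two monomorphisms with the same source. -/
theorem SES.exists_pushout (h₁ : SES X Y Z) (h₂ : SES X Q C) :
    ∃ W : ModuleCat.{v} A, SES Q W Z ∧ SES Y W C := by
  obtain ⟨f, g, h₁⟩ := h₁
  obtain ⟨a, b, h₂⟩ := h₂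
  have hfg : ∀ x, g (f x) = 0 := h₁.exact.apply_apply_eq_zero
  have hab : ∀ x, b (a x) = 0 := h₂.exact.apply_apply_eq_zero
  let j : X →ₗ[A] Y × Q := f.prod (-a)
  let p := (LinearMap.range j).mkQ
  have hp : ∀ w, p w = 0 ↔ ∃ x, f x = w.1 ∧ -a x = w.2 := by
    intro w
    rw [Submodule.mkQ_apply, Submodule.Quotient.mk_eq_zero]
    exact exists_congr fun x => Prod.ext_iff
  let qZ : ((Y × Q) ⧸ LinearMap.range j) →ₗ[A] Z :=
    (LinearMap.range j).liftQ (g ∘ₗ LinearMap.fst A Y Q) (by rintro _ ⟨x, rfl⟩; simp [j, hfg])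
  let qC : ((Y × Q) ⧸ LinearMap.range j) →ₗ[A] C :=
    (LinearMap.range j).liftQ (b ∘ₗ LinearMap.snd A Y Q) (by rintro _ ⟨x, rfl⟩; simp [j, hab])
  refine ⟨ModuleCat.of A ((Y × Q) ⧸ LinearMap.range j),
    ⟨p ∘ₗ LinearMap.inr A Y Q, qZ, ?_, ?_, ?_⟩, ⟨p ∘ₗ LinearMap.inl A Y Q, qC, ?_, ?_, ?_⟩⟩
  · rw [injective_iff_map_eq_zero]
    intro q hq
    obtain ⟨x, hx, hx'⟩ := (hp _).1 hq
    rw [LinearMap.inr_apply] at hx hx'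
    rw [h₁.inj (hx.trans (map_zero f).symm)] at hx'
    simpa using hx'.symm
  · intro w
    obtain ⟨⟨y, q⟩, rfl⟩ := Submodule.mkQ_surjective _ w
    change g y = 0 ↔ _
    rw [h₁.exact]
    constructor
    · rintro ⟨x, rfl⟩
      refine ⟨q + a x, ?_⟩
      change p _ = p _
      rw [← sub_eq_zero, ← map_sub, hp]
      exact ⟨-x, by simp⟩
    · rintro ⟨q', hq'⟩
      change p _ = p _ at hq'
      rw [← sub_eq_zero, ← map_sub, hp] at hq'
      obtain ⟨x, hx, -⟩ := hq'
      exact ⟨-x, by simp [hx]⟩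
  · intro z
    obtain ⟨y, rfl⟩ := h₁.surj z
    exact ⟨p (y, 0), rfl⟩
  · rw [injective_iff_map_eq_zero]
    intro y hy
    obtain ⟨x, hx, hx'⟩ := (hp _).1 hy
    rw [LinearMap.inl_apply] at hx hx'
    have hx0 : a x = a 0 := by simpa using hx'
    rw [h₂.inj hx0] at hx
    simpa using hx.symm
  · intro w
    obtain ⟨⟨y, q⟩, rfl⟩ := Submodule.mkQ_surjective _ w
    change b q = 0 ↔ _
    rw [h₂.exact]
    constructor
    · rintro ⟨x, rfl⟩
      refine ⟨y + f x, ?_⟩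
      change p _ = p _
      rw [← sub_eq_zero, ← map_sub, hp]
      exact ⟨x, by simp⟩
    · rintro ⟨y', hy'⟩
      change p _ = p _ at hy'
      rw [← sub_eq_zero, ← map_sub, hp] at hy'
      obtain ⟨x, -, hx⟩ := hy'
      exact ⟨x, by simpa using hx⟩
  · intro c
    obtain ⟨q, rfl⟩ := h₂.surj c
    exact ⟨p (0, q), rfl⟩

/-- The pullback of two epimorphisms with the same target. -/
theorem SES.exists_pullback (h₁ : SES X Y Z) (h₂ : SES K Q Z) :
    ∃ W : ModuleCat.{v} A, SES X W Q ∧ SES K W Y := by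
  obtain ⟨f, g, h₁⟩ := h₁
  obtain ⟨a, b, h₂⟩ := h₂
  have hfg : ∀ x, g (f x) = 0 := h₁.exact.apply_apply_eq_zero
  have hab : ∀ x, b (a x) = 0 := h₂.exact.apply_apply_eq_zero
  let d : Y × Q →ₗ[A] Z := g.coprod (-b)
  have hd : ∀ w, d w = 0 ↔ g w.1 = b w.2 := fun w => by
    simp [d, ← sub_eq_add_neg, sub_eq_zero]
  refine ⟨ModuleCat.of A (LinearMap.ker d),
    ⟨(LinearMap.inl A Y Q ∘ₗ f).codRestrict _ (fun x => by simp [hd, hfg]),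
      LinearMap.snd A Y Q ∘ₗ Submodule.subtype _, ?_, ?_, ?_⟩,
    ⟨(LinearMap.inr A Y Q ∘ₗ a).codRestrict _ (fun x => by simp [hd, hab]),
      LinearMap.fst A Y Q ∘ₗ Submodule.subtype _, ?_, ?_, ?_⟩⟩
  · exact fun x y hxy => h₁.inj (congrArg (fun w : LinearMap.ker d => w.1.1) hxy)
  · rintro ⟨⟨y, q⟩, hw⟩
    have hw' := (hd _).1 hw
    constructor
    · rintro (rfl : q = 0)
      obtain ⟨x, rfl⟩ := (h₁.exact y).1 (by simpa using hw')
      exact ⟨x, rfl⟩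
    · rintro ⟨x, hx⟩
      exact (congrArg (fun w : LinearMap.ker d => w.1.2) hx).symm
  · intro q
    obtain ⟨y, hy⟩ := h₁.surj (b q)
    exact ⟨⟨(y, q), (hd _).2 hy⟩, rfl⟩
  · exact fun x y hxy => h₂.inj (congrArg (fun w : LinearMap.ker d => w.1.2) hxy)
  · rintro ⟨⟨y, q⟩, hw⟩
    have hw' := (hd _).1 hw
    constructor
    · rintro (rfl : y = 0)
      obtain ⟨x, rfl⟩ := (h₂.exact q).1 (by simpa using hw'.symm)
      exact ⟨x, rfl⟩
    · rintro ⟨x, hx⟩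
      exact (congrArg (fun w : LinearMap.ker d => w.1.1) hx).symm
  · intro y
    obtain ⟨q, hq⟩ := h₂.surj (g y)
    exact ⟨⟨(y, q), (hd _).2 hq.symm⟩, rfl⟩

theorem SES.exists_injective (h : SES X Y Z) : ∃ f : X →ₗ[A] Y, Function.Injective f :=
  let ⟨f, _, h⟩ := h
  ⟨f, h.inj⟩

theorem SES.exists_surjective (h : SES X Y Z) : ∃ g : Y →ₗ[A] Z, Function.Surjective g :=
  let ⟨_, g, h⟩ := h
  ⟨g, h.surj⟩

/-- Every module is a quotient of a projective one. -/
theorem exists_projective_cover (X : ModuleCat.{v} A) :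
    ∃ K P : ModuleCat.{v} A, Projective P ∧ SES K P X := by
  let e := Finsupp.linearCombination A (id : X → X)
  have he : Function.Surjective e := Finsupp.linearCombination_id_surjective A X
  exact ⟨ModuleCat.of A (LinearMap.ker e), ModuleCat.of A (X →₀ A), ModuleCat.projective_of_free Finsupp.basisSingleOne,
    _, e, isShortExact_ker_subtype (Y := ModuleCat.of A (X →₀ A)) he⟩

/-- A finitely generated module is a quotient of a finitely generated projective one. -/
theorem exists_finite_projective_cover (X : ModuleCat.{v} A) [Module.Finite A X] :
    ∃ K P : ModuleCat.{v} A, Projective P ∧ Module.Finite A P ∧ SES K P X := by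
  obtain ⟨n, f, hf⟩ := Module.Finite.exists_fin' A X
  exact ⟨ModuleCat.of A (LinearMap.ker f), ModuleCat.of A (Fin n → A), ModuleCat.projective_of_free (Pi.basisFun A (Fin n)),
    inferInstanceAs (Module.Finite A (Fin n → A)), _, f, isShortExact_ker_subtype (Y := ModuleCat.of A (Fin n → A)) hf⟩

instance projective_prod (X Y : ModuleCat.{v} A) [Projective X] [Projective Y] :
    Projective (ModuleCat.of A (X × Y)) :=
  (IsProjective.iff_projective _).1 inferInstance

theorem SES.ext_right (h : SES X Y Z) (N : ModuleCat.{v} A) (i : ℕ)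
    (hY : Subsingleton (Ext N Y i)) (hX : Subsingleton (Ext N X (i + 1))) :
    Subsingleton (Ext N Z i) := by
  obtain ⟨f, g, h⟩ := h
  refine subsingleton_of_forall_eq 0 fun e => ?_
  obtain ⟨x, rfl⟩ := Ext.covariant_sequence_exact₃ N h.shortExact e rfl (Subsingleton.elim _ _)
  rw [Subsingleton.elim x 0, Ext.zero_comp]

theorem SES.ext_middle (h : SES X Y Z) (N : ModuleCat.{v} A) (i : ℕ)
    (hX : Subsingleton (Ext X N i)) (hZ : Subsingleton (Ext Z N i)) :
    Subsingleton (Ext Y N i) := by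
  obtain ⟨f, g, h⟩ := h
  refine subsingleton_of_forall_eq 0 fun e => ?_
  obtain ⟨x, rfl⟩ := Ext.contravariant_sequence_exact₂ h.shortExact N e (Subsingleton.elim _ _)
  rw [Subsingleton.elim x 0, Ext.comp_zero]

theorem SES.ext_left (h : SES X Y Z) (N : ModuleCat.{v} A) (i : ℕ)
    (hY : Subsingleton (Ext Y N i)) (hZ : Subsingleton (Ext Z N (i + 1))) :
    Subsingleton (Ext X N i) := by
  obtain ⟨f, g, h⟩ := h
  refine subsingleton_of_forall_eq 0 fun e => ?_
  obtain ⟨x, rfl⟩ := Ext.contravariant_sequence_exact₁ h.shortExact N e (add_comm 1 i)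
    (Subsingleton.elim _ _)
  rw [Subsingleton.elim x 0, Ext.comp_zero]

theorem SES.ext_third (h : SES X Y Z) (N : ModuleCat.{v} A) (i : ℕ)
    (hX : Subsingleton (Ext X N i)) (hY : Subsingleton (Ext Y N (i + 1))) :
    Subsingleton (Ext Z N (i + 1)) := by
  obtain ⟨f, g, h⟩ := h
  refine subsingleton_of_forall_eq 0 fun e => ?_
  obtain ⟨x, rfl⟩ := Ext.contravariant_sequence_exact₃ h.shortExact N e
    (Subsingleton.elim _ _) (add_comm 1 i)
  rw [Subsingleton.elim x 0, Ext.comp_zero]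

/-- The first `Ext` group out of the cokernel vanishes if maps extend along the inclusion into a
projective module. -/
theorem IsShortExact.ext_one_of_extend {f : X →ₗ[A] Y} {g : Y →ₗ[A] Z} (h : IsShortExact f g)
    (hY : Projective Y) (hN : ∀ φ : X →ₗ[A] N, ∃ ψ : Y →ₗ[A] N, ψ ∘ₗ f = φ) :
    Subsingleton (Ext Z N 1) := by
  refine subsingleton_of_forall_eq 0 fun e => ?_
  obtain ⟨x, rfl⟩ := Ext.contravariant_sequence_exact₃ h.shortExact N e
    (Ext.eq_zero_of_projective _) (add_comm 1 0)
  obtain ⟨φ, rfl⟩ := Ext.mk₀_bijective _ _ |>.2 x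
  obtain ⟨ψ, hψ⟩ := hN φ.hom
  have : φ = h.toShortComplex.f ≫ ModuleCat.ofHom ψ := by
    ext1
    exact hψ.symm
  rw [this, ← Ext.mk₀_comp_mk₀, h.shortExact.extClass_comp_assoc]

theorem SES.hasProjectiveDimensionLT_third (h : SES X Y Z) (n : ℕ)
    (h₁ : HasProjectiveDimensionLT X n) (h₂ : HasProjectiveDimensionLT Y (n + 1)) :
    HasProjectiveDimensionLT Z (n + 1) := by
  obtain ⟨f, g, h⟩ := h
  exact h.shortExact.hasProjectiveDimensionLT_X₃ n h₁ h₂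

theorem SES.hasProjectiveDimensionLT_middle (h : SES X Y Z) (n : ℕ)
    (h₁ : HasProjectiveDimensionLT X n) (h₂ : HasProjectiveDimensionLT Z n) :
    HasProjectiveDimensionLT Y n := by
  obtain ⟨f, g, h⟩ := h
  exact h.shortExact.hasProjectiveDimensionLT_X₂ n h₁ h₂

theorem SES.hasProjectiveDimensionLT_first (h : SES X Y Z) (n : ℕ)
    (h₁ : HasProjectiveDimensionLT Y n) (h₂ : HasProjectiveDimensionLT Z (n + 1)) :
    HasProjectiveDimensionLT X n := by
  obtain ⟨f, g, h⟩ := h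
  exact h.shortExact.hasProjectiveDimensionLT_X₁ n h₁ h₂

end ShortExactSequences

/-! ### Closure properties of Gorenstein-projective modules, in coinductive form -/

section Coresolution

variable {A : Type v} [Ring A]

/-- All positive `Ext` groups from `M` to projective modules vanish. -/
def ExtProjVanish (M : ModuleCat.{v} A) : Prop :=
  ∀ Q : ModuleCat.{v} A, Projective Q → ∀ i : ℕ, Subsingleton (Ext M Q (i + 1))

/-- A class of modules without positive extensions by projective modules each of whose members
embeds in a projective module with cokernel in the class. -/
def IsCoresolving (𝒳 : ModuleCat.{v} A → Prop) : Prop :=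
  ∀ M, 𝒳 M → ExtProjVanish M ∧ ∃ P N, Projective P ∧ SES M P N ∧ 𝒳 N

/-- `M` belongs to a coresolving class. This is shown to be equivalent to `M` being
Gorenstein-projective. -/
def HasCoresolution (M : ModuleCat.{v} A) : Prop :=
  ∃ 𝒳, IsCoresolving 𝒳 ∧ 𝒳 M

variable {X Y Z M N G P C Q K : ModuleCat.{v} A}

theorem HasCoresolution.extProjVanish (h : HasCoresolution M) : ExtProjVanish M :=
  let ⟨_, h𝒳, hM⟩ := h
  (h𝒳 M hM).1

theorem HasCoresolution.exists_ses (h : HasCoresolution M) :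
    ∃ P N, Projective P ∧ SES M P N ∧ HasCoresolution N :=
  let ⟨𝒳, h𝒳, hM⟩ := h
  let ⟨P, N, hP, hS, hN⟩ := (h𝒳 M hM).2
  ⟨P, N, hP, hS, 𝒳, h𝒳, hN⟩

theorem HasCoresolution.of_ses (hG : ExtProjVanish G) (hP : Projective P) (h : SES G P C)
    (hC : HasCoresolution C) : HasCoresolution G := by
  refine ⟨fun M => HasCoresolution M ∨ M = G, ?_, .inr rfl⟩
  rintro M (hM | rfl)
  · obtain ⟨P, N, hP, hS, hN⟩ := hM.exists_ses
    exact ⟨hM.extProjVanish, P, N, hP, hS, .inl hN⟩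
  · exact ⟨hG, P, C, hP, h, .inl hC⟩

theorem ExtProjVanish.of_projective (hP : Projective P) : ExtProjVanish P :=
  fun Q _ i => Ext.subsingleton_of_projective P Q i

theorem ExtProjVanish.of_ses_left (h : SES G P C) (hP : ExtProjVanish P) (hC : ExtProjVanish C) :
    ExtProjVanish G :=
  fun Q hQ i => h.ext_left Q _ (hP Q hQ i) (hC Q hQ (i + 1))

/-- The kernel of a map from a projective module onto a member of the class is in the class. -/
theorem HasCoresolution.kernel (h : SES G P C) (hP : Projective P) (hC : HasCoresolution C) :
    HasCoresolution G :=
  .of_ses (.of_ses_left h (.of_projective hP) hC.extProjVanish) hP h hC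

theorem HasCoresolution.of_projective (hP : Projective P) : HasCoresolution P := by
  -- The split sequence M → M × M → M stays inside the class of projective modules.
  refine ⟨Projective, fun M hM => ⟨.of_projective hM, ModuleCat.of A (M × M), M, ?_,
    ses_prod M M, hM⟩, hP⟩
  infer_instance

/-- A horseshoe argument: push Y out along X → P. The result splits as P × Z because Ext¹(Z, P) = 0,
and it embeds in P × Q. The cokernel of Y → P × Q is an extension of Z' by X', so the class of all
such extensions is coresolving. -/
theorem HasCoresolution.extension (h : SES X Y Z) (hX : HasCoresolution X)
    (hZ : HasCoresolution Z) : HasCoresolution Y := by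
  refine ⟨fun Y => ∃ X Z, HasCoresolution X ∧ HasCoresolution Z ∧ SES X Y Z, ?_, X, Z, hX, hZ, h⟩
  rintro Y ⟨X, Z, hX, hZ, h⟩
  refine ⟨fun Q hQ i => h.ext_middle Q _ (hX.extProjVanish Q hQ i) (hZ.extProjVanish Q hQ i), ?_⟩
  obtain ⟨P, X', hP, hPX, hX'⟩ := hX.exists_ses
  obtain ⟨Q, Z', hQ, hQZ, hZ'⟩ := hZ.exists_ses
  obtain ⟨W, hW, hW'⟩ := h.exists_pushout hPX
  obtain ⟨e⟩ := hW.split (hZ.extProjVanish P hP 0)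
  obtain ⟨L, hL, hL'⟩ := hW'.exists_quotient ((hQZ.prod_left P).congr_left e)
  exact ⟨_, L, inferInstance, hL, X', Z', hX', hZ', hL'⟩

theorem HasCoresolution.congr (h : HasCoresolution M) (e : M ≃ₗ[A] N) : HasCoresolution N := by
  refine ⟨fun N => ∃ M, HasCoresolution M ∧ Nonempty (M ≃ₗ[A] N), ?_, M, h, ⟨e⟩⟩
  rintro N ⟨M, hM, ⟨e⟩⟩
  obtain ⟨P, M', hP, hS, hM'⟩ := hM.exists_ses
  -- The isomorphism is viewed as a sequence with zero cokernel, so that Ext vanishing passes from M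
  -- to N.
  have hz : SES N M (ModuleCat.of A PUnit) :=
    ⟨e.symm, 0, e.symm.injective, fun x => ⟨fun _ => ⟨e x, by simp⟩, fun _ => rfl⟩,
      fun x => ⟨0, rfl⟩⟩
  have : Limits.IsZero (ModuleCat.of A PUnit.{v + 1}) :=
    ModuleCat.isZero_of_subsingleton _
  refine ⟨.of_ses_left hz hM.extProjVanish (.of_projective this.projective), P, M', hP,
    hS.congr_left e.symm, M', hM', ⟨.refl _ _⟩⟩

/-- The class is closed under direct summands. -/
theorem HasCoresolution.of_prod (h : HasCoresolution (ModuleCat.of A (X × Y))) :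
    HasCoresolution X := by
  refine ⟨fun X => ∃ Y : ModuleCat.{v} A, HasCoresolution (ModuleCat.of A (X × Y)), ?_, Y, h⟩
  rintro X ⟨Y, h⟩
  refine ⟨fun Q hQ i => ?_, ?_⟩
  · have := h.extProjVanish Q hQ i
    refine subsingleton_of_forall_eq 0 fun e => ?_
    have hc : ModuleCat.ofHom (LinearMap.inl A X Y) ≫ ModuleCat.ofHom (LinearMap.fst A X Y)
        = 𝟙 X := rfl
    rw [← e.mk₀_id_comp, ← hc, ← Ext.mk₀_comp_mk₀, Ext.comp_assoc_of_second_deg_zero,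
      Subsingleton.elim ((Ext.mk₀ (ModuleCat.ofHom (LinearMap.fst A X Y))).comp e _) 0,
      Ext.comp_zero]
  · obtain ⟨Q, C, hQ, hS, hC⟩ := h.exists_ses
    -- With L = Q / X, the module X × L is an extension of C by X × Y, hence in the class. So L is
    -- again a summand of a member, with complement X, and the embedding can be repeated.
    obtain ⟨L, hL, hL'⟩ := (ses_prod X Y).exists_quotient hS
    refine ⟨Q, L, hQ, hL, X, ?_⟩
    have hL₂ := hL'.prod_left X
    have : HasCoresolution (ModuleCat.of A (X × L)) := h.extension hL₂ hC
    exact this.congr (LinearEquiv.prodComm A X L)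

/-- A quotient without extensions by projective modules, of a projective module by a member of the
class, is in the class. -/
theorem HasCoresolution.cokernel (h : SES G P C) (hP : Projective P) (hG : HasCoresolution G)
    (hC : ∀ Q : ModuleCat.{v} A, Projective Q → Subsingleton (Ext C Q 1)) :
    HasCoresolution C := by
  obtain ⟨Q, D, hQ, hS, hD⟩ := hG.exists_ses
  -- The pushout W is an extension of D by P, hence in the class, and it splits as Q × C because
  -- Ext¹(C, Q) = 0.
  obtain ⟨W, hW, hW'⟩ := h.exists_pushout hS
  obtain ⟨e⟩ := hW.split (hC Q hQ)
  have := (HasCoresolution.of_projective hP).extension hW' hD |>.congr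
    (N := ModuleCat.of A (C × Q)) (e.trans (LinearEquiv.prodComm A Q C))
  exact this.of_prod

end Coresolution

/-! ### Hulls of finite projective dimension -/

section ProjectiveDimension

variable {A : Type v} [Ring A] {X Y Z M N G P C Q K : ModuleCat.{v} A}

/-- No extensions of a Gorenstein-projective module by a module of finite projective dimension. -/
theorem ExtProjVanish.ext_subsingleton (hG : ExtProjVanish G) (n : ℕ)
    (hN : HasProjectiveDimensionLT N (n + 1)) (i : ℕ) : Subsingleton (Ext G N (i + 1)) := by
  induction n generalizing N i with
  | zero => exact hG N (projective_iff_hasProjectiveDimensionLT_one.2 hN) i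
  | succ n ih =>
    obtain ⟨K, P, hP, h⟩ := exists_projective_cover N
    have hK := h.hasProjectiveDimensionLT_first (n + 1) inferInstance hN
    exact h.ext_right G _ (hG P hP i) (ih hK (i + 1))

/-- `M` embeds in a module of projective dimension at most `n`, finitely generated if `fin`
holds, with Gorenstein-projective cokernel. -/
def HasHull (fin : Prop) (n : ℕ) (M : ModuleCat.{v} A) : Prop :=
  ∃ L C : ModuleCat.{v} A, SES M L C ∧ HasProjectiveDimensionLE L n ∧ HasCoresolution C ∧
    (fin → Module.Finite A L)

theorem HasHull.mono {fin : Prop} {m n : ℕ} (h : HasHull fin m M) (hmn : m ≤ n) :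
    HasHull fin n M := by
  obtain ⟨L, C, hS, hL, hC, hf⟩ := h
  exact ⟨L, C, hS, hasProjectiveDimensionLT_of_ge _ (m + 1) _ (by lia), hC, hf⟩

theorem HasCoresolution.hasHull (h : HasCoresolution M) : HasHull False 0 M :=
  let ⟨P, N, hP, hS, hN⟩ := h.exists_ses
  ⟨P, N, hS, (projective_iff_hasProjectiveDimensionLE_zero _).1 hP, hN, False.elim⟩

theorem HasHull.hasCoresolution {fin : Prop} (h : HasHull fin 0 M) : HasCoresolution M :=
  let ⟨_, _, hS, hL, hC, _⟩ := h
  .kernel hS ((projective_iff_hasProjectiveDimensionLE_zero _).2 hL) hC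

theorem SES.finite (h : SES X Y Z) [Module.Finite A Y] : Module.Finite A Z :=
  let ⟨_, hg⟩ := h.exists_surjective
  .of_surjective _ hg

theorem SES.finite_middle (h : SES X Y Z) [Module.Finite A X] [Module.Finite A Z] :
    Module.Finite A Y := by
  obtain ⟨f, g, h⟩ := h
  have : Module.Finite A (LinearMap.ker g) := by
    rw [h.exact.linearMap_ker_eq]
    infer_instance
  have := Module.Finite.equiv (g.quotKerEquivOfSurjective h.surj).symm
  exact .of_submodule_quotient (LinearMap.ker g)

/-- A module of finite projective dimension is its own hull. -/
theorem hasHull_of_hasProjectiveDimensionLE (n : ℕ) (h : HasProjectiveDimensionLE M n) :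
    HasHull False n M := by
  refine ⟨M, ModuleCat.of A PUnit, ⟨LinearMap.id, 0, Function.injective_id,
    fun x => ⟨fun _ => ⟨x, rfl⟩, fun _ => rfl⟩, fun x => ⟨0, rfl⟩⟩, h,
    .of_projective (ModuleCat.isZero_of_subsingleton (ModuleCat.of A PUnit.{v + 1})).projective,
    False.elim⟩

/-- Passing to a syzygy with respect to a Gorenstein-projective module lowers the projective
dimension of the hull. -/
theorem HasHull.syzygy {fin : Prop} {n : ℕ} (h : HasHull fin (n + 1) M) (hS : SES K G M)
    (hG : HasCoresolution G) : HasHull False n K := by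
  obtain ⟨L, C, hML, hL, hC, -⟩ := h
  obtain ⟨K', P, hP, hKP⟩ := exists_projective_cover L
  have hK' : HasProjectiveDimensionLE K' n :=
    hKP.hasProjectiveDimensionLT_first (n + 1) inferInstance hL
  -- G' is the preimage of M in P: the kernel of P → C, so Gorenstein-projective, and an extension
  -- of M by K'.
  obtain ⟨G', hG', hG'C⟩ := hKP.exists_preimage hML
  have hG'c := HasCoresolution.kernel hG'C hP hC
  -- The pullback W splits as K' × G, so it embeds in K' × Q with cokernel D. This module is the new
  -- hull of K; its quotient by K is an extension of D by W / K ≅ G'.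
  obtain ⟨W, hW, hW'⟩ := hS.exists_pullback hG'
  obtain ⟨e⟩ := hW'.split (hG.extProjVanish.ext_subsingleton n hK' 0)
  obtain ⟨Q, D, hQ, hGQ, hD⟩ := hG.exists_ses
  have hWL := (hGQ.prod_left K').congr_left e
  have hdim : HasProjectiveDimensionLE (ModuleCat.of A (K' × Q)) n :=
    (ses_prod K' Q).hasProjectiveDimensionLT_middle _ hK'
      (hasProjectiveDimensionLT_of_ge _ 1 _ (by lia))
  obtain ⟨L', hL', hL'D⟩ := hW.exists_quotient hWL
  exact ⟨_, L', hL', hdim, hG'c.extension hL'D hD, False.elim⟩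

/-- The converse of `HasHull.syzygy`, given suitable embeddings of Gorenstein-projective modules
in projective ones. -/
theorem HasHull.of_syzygy {fin : Prop} {n : ℕ} (h : HasHull fin n K) (hS : SES K G M)
    (hG : HasCoresolution G)
    (hemb : ∀ W : ModuleCat.{v} A, HasCoresolution W → (fin → Module.Finite A W) → HasHull fin 0 W)
    (hfin : fin → Module.Finite A G) :
    HasHull fin (n + 1) M := by
  obtain ⟨L', C', hKL, hL', hC', hf⟩ := h
  -- W is Gorenstein-projective as an extension of C' by G. Embedding it in Q makes L = Q / L' the
  -- hull of M ≅ W / L', with the same cokernel C.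
  obtain ⟨W, hW, hW'⟩ := hS.exists_pushout hKL
  have hWc := hG.extension hW' hC'
  obtain ⟨Q, C, hWQ, hQ, hC, hQf⟩ := hemb W hWc fun hfn => by
    have := hfin hfn
    have := hf hfn
    have := hKL.finite
    exact hW'.finite_middle
  obtain ⟨L, hL, hML⟩ := hW.exists_quotient hWQ
  refine ⟨L, C, hML, hL.hasProjectiveDimensionLT_third (n + 1) hL' ?_, hC, fun hfn => ?_⟩
  · exact hasProjectiveDimensionLT_of_ge _ 1 _ (by lia)
  · have := hQf hfn
    exact hL.finite

/-- A module of finite projective dimension with a hull of projective dimension at most `n` has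
projective dimension at most `n`. -/
theorem HasHull.hasProjectiveDimensionLE {fin : Prop} {n m : ℕ} (h : HasHull fin n M)
    (hM : HasProjectiveDimensionLE M m) : HasProjectiveDimensionLE M n := by
  obtain ⟨L, C, hML, hL, hC, -⟩ := h
  obtain ⟨e⟩ := hML.split (hC.extProjVanish.ext_subsingleton m hM 0)
  let r : Retract M L :=
    { i := ModuleCat.ofHom (e.symm ∘ₗ LinearMap.inl A M C)
      r := ModuleCat.ofHom (LinearMap.fst A M C ∘ₗ e)
      retract := by ext x; simp }
  exact r.hasProjectiveDimensionLT (n + 1)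

end ProjectiveDimension

/-! ### Finitely generated hulls over an artin algebra -/

section Finite

variable {A : Type v} [Ring A] {X Y Z M N G P C Q K : ModuleCat.{v} A}

/-- If linear forms on a finitely generated module `M` extend along `Φ : M → F`, then so do linear
maps from `M` to any projective module. -/
theorem extend_projective_of_extend_forms {M F Q : Type v} [AddCommGroup M] [AddCommGroup F]
    [AddCommGroup Q] [Module A M] [Module A F] [Module A Q] [Module.Finite A M]
    [Module.Projective A Q] (Φ : M →ₗ[A] F)
    (hΦ : ∀ ψ : M →ₗ[A] A, ∃ χ : F →ₗ[A] A, χ ∘ₗ Φ = ψ) (ψ : M →ₗ[A] Q) :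
    ∃ χ : F →ₗ[A] Q, χ ∘ₗ Φ = ψ := by
  classical
  obtain ⟨s, hs⟩ := (Module.projective_def' (R := A) (P := Q)).1 inferInstance
  obtain ⟨S, hS⟩ := Module.Finite.fg_top (R := A) (M := M)
  let f : M →ₗ[A] (Q →₀ A) := s ∘ₗ ψ
  -- After embedding Q in a free module, only the coordinates in T are nonzero on the generators of
  -- M, so finitely many forms have to be extended.
  let T : Finset Q := S.biUnion fun x => (f x).support
  choose χ hχ using fun q => hΦ (Finsupp.lapply q ∘ₗ f)
  refine ⟨Finsupp.linearCombination A id ∘ₗ ∑ q ∈ T, Finsupp.lsingle q ∘ₗ χ q, ?_⟩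
  have key : (∑ q ∈ T, Finsupp.lsingle q ∘ₗ χ q) ∘ₗ Φ = f := by
    refine LinearMap.ext_on hS fun x hx => ?_
    have h₁ : ∀ q, χ q (Φ x) = f x q := fun q => LinearMap.congr_fun (hχ q) x
    have hsub : (f x).support ⊆ T := Finset.subset_biUnion_of_mem (fun x => (f x).support) hx
    simp only [LinearMap.comp_apply, LinearMap.sum_apply, h₁, Finsupp.lsingle_apply]
    conv_rhs => rw [← Finsupp.sum_single (f x)]
    rw [Finsupp.sum_of_support_subset _ hsub _ (by simp)]
  rw [LinearMap.comp_assoc, key, ← LinearMap.comp_assoc, hs, LinearMap.id_comp]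

/-- Over an artin algebra, linear forms on a finitely generated module `M` all factor through one
map from `M` to a free module of finite rank. -/
theorem exists_universal_form (R : Type u) [CommRing R] [IsNoetherianRing R] [Algebra R A]
    [Module.Finite R A] (M : Type v) [AddCommGroup M] [Module A M] [Module.Finite A M] :
    ∃ (k : ℕ) (Φ : M →ₗ[A] (Fin k → A)),
      ∀ ψ : M →ₗ[A] A, ∃ χ : (Fin k → A) →ₗ[A] A, χ ∘ₗ Φ = ψ := by
  obtain ⟨n, p, hp⟩ := Module.Finite.exists_fin' A M
  -- A form is determined by its values on n generators, so Hom_A(M, A) embeds R-linearly in the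
  -- noetherian R-module A^n.
  let ev : (M →ₗ[A] A) →ₗ[R] (Fin n → A) :=
    { toFun := fun ψ i => ψ (p (Pi.single i 1))
      map_add' := fun _ _ => rfl
      map_smul' := fun _ _ => rfl }
  have hev : Function.Injective ev := by
    intro ψ ψ' h
    rw [← LinearMap.cancel_right hp]
    refine LinearMap.pi_ext' fun i => LinearMap.ext_ring ?_
    exact congrFun h i
  have : IsNoetherian R (M →ₗ[A] A) := isNoetherian_of_injective ev hev
  obtain ⟨k, φ, hφ⟩ := Module.Finite.exists_fin (R := R) (M := M →ₗ[A] A)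
  refine ⟨k, LinearMap.pi φ, fun ψ => ?_⟩
  have hψ : ψ ∈ Submodule.span R (Set.range φ) := hφ ▸ Submodule.mem_top
  obtain ⟨c, rfl⟩ := (Submodule.mem_span_range_iff_exists_fun R).1 hψ
  refine ⟨∑ i, c i • LinearMap.proj i, ?_⟩
  ext x
  simp

/-- The universal map Φ : M → A^k is injective because some embedding of M in a projective module
factors through it. Since all maps from M to projectives extend along Φ, its cokernel has no Ext¹
into projectives, and `HasCoresolution.cokernel` applies. -/
theorem HasCoresolution.hasHull_finite (R : Type u) [CommRing R] [IsNoetherianRing R]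
    [Algebra R A] [Module.Finite R A] [Module.Finite A M] (h : HasCoresolution M) :
    HasHull True 0 M := by
  obtain ⟨k, Φ, hΦ⟩ := exists_universal_form (A := A) R M
  have hext : ∀ (Q : ModuleCat.{v} A), Projective Q → ∀ φ : M →ₗ[A] Q,
      ∃ ψ : (Fin k → A) →ₗ[A] Q, ψ ∘ₗ Φ = φ := fun Q hQ φ =>
    extend_projective_of_extend_forms Φ hΦ φ
  obtain ⟨Q, N, hQ, hS, -⟩ := h.exists_ses
  obtain ⟨f, hf⟩ := hS.exists_injective
  obtain ⟨ψ, hψ⟩ := hext Q hQ f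
  have hinj : Function.Injective Φ := by
    rw [← hψ, LinearMap.coe_comp] at hf
    exact hf.of_comp
  have hse := isShortExact_mkQ (X := M) (Y := ModuleCat.of A (Fin k → A)) hinj
  have hP : Projective (ModuleCat.of A (Fin k → A)) :=
    ModuleCat.projective_of_free (Pi.basisFun A (Fin k))
  have hses : SES M (ModuleCat.of A (Fin k → A)) (ModuleCat.of A ((Fin k → A) ⧸ LinearMap.range Φ))
    := ⟨_, _, hse⟩
  refine ⟨_, _, hses, (projective_iff_hasProjectiveDimensionLE_zero _).1 hP,
    .cokernel hses hP h fun Q hQ => ?_, fun _ => inferInstanceAs (Module.Finite A (Fin k → A))⟩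
  exact IsShortExact.ext_one_of_extend (X := M) (Y := ModuleCat.of A (Fin k → A))
    (Z := ModuleCat.of A ((Fin k → A) ⧸ LinearMap.range Φ)) hse hP (hext Q hQ)

/-- Over an artin algebra, a finitely generated module with a hull has a finitely generated one. -/
theorem HasHull.finite (R : Type u) [CommRing R] [IsNoetherianRing R]
    [Algebra R A] [Module.Finite R A] [Module.Finite A M] {fin : Prop} {n : ℕ}
    (h : HasHull fin n M) : HasHull True n M := by
  have : IsNoetherianRing A := isNoetherian_of_tower R (inferInstanceAs (IsNoetherian R A))
  induction n generalizing M fin with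
  | zero => exact h.hasCoresolution.hasHull_finite R
  | succ n ih =>
    obtain ⟨K, P, hP, hPf, hS⟩ := exists_finite_projective_cover M
    obtain ⟨f, hf⟩ := hS.exists_injective
    have := Module.Finite.of_injective f hf
    have hPc := HasCoresolution.of_projective hP
    refine HasHull.of_syzygy (ih (h.syzygy hS hPc)) hS hPc (fun W hW hWf => ?_) fun _ => hPf
    have := hWf trivial
    exact hW.hasHull_finite R

end Finite

/-! ### Exactness of complexes and of their Hom complexes in terms of elements and maps -/

section Complexes

variable {A : Type v} [Ring A]

theorem exactAt_iff_forall {ι : Type*} {c : ComplexShape ι}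
    (X : HomologicalComplex (ModuleCat.{v} A) c) {i j k : ι} (hi : c.prev j = i)
    (hk : c.next j = k) :
    X.ExactAt j ↔ ∀ x : X.X j, X.d j k x = 0 → ∃ y, X.d i j y = x := by
  rw [X.exactAt_iff' i j k hi hk, ShortComplex.moduleCat_exact_iff]
  rfl

theorem homFromComplex_exactAt_iff {ι : Type*} {c : ComplexShape ι}
    (X : HomologicalComplex (ModuleCat.{v} A) c) (N : ModuleCat.{v} A) {i j k : ι}
    (hi : c.prev j = i) (hk : c.next j = k) :
    (homFromComplex X N).ExactAt j ↔
      ∀ φ : X.X j ⟶ N, X.d i j ≫ φ = 0 → ∃ ψ : X.X k ⟶ N, X.d j k ≫ ψ = φ := by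
  rw [HomologicalComplex.exactAt_iff' (homFromComplex X N) k j i hk hi,
    ShortComplex.ab_exact_iff]
  rfl

theorem homToComplex_exactAt_iff {ι : Type*} {c : ComplexShape ι}
    (X : HomologicalComplex (ModuleCat.{v} A) c) (N : ModuleCat.{v} A) {i j k : ι}
    (hi : c.prev j = i) (hk : c.next j = k) :
    (homToComplex N X).ExactAt j ↔
      ∀ φ : N ⟶ X.X j, φ ≫ X.d j k = 0 → ∃ ψ : N ⟶ X.X i, ψ ≫ X.d i j = φ := by
  rw [HomologicalComplex.exactAt_iff' _ i j k hi hk, ShortComplex.ab_exact_iff]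
  rfl

theorem range_iCycles {ι : Type*} {c : ComplexShape ι}
    (X : HomologicalComplex (ModuleCat.{v} A) c) {j k : ι} (hk : c.next j = k) (x : X.X j) :
    X.d j k x = 0 ↔ ∃ y, X.iCycles j y = x := by
  have h := ShortComplex.exact_of_f_is_kernel (ShortComplex.mk _ _ (X.iCycles_d j k))
    (X.cyclesIsKernel j k hk)
  rw [ShortComplex.moduleCat_exact_iff] at h
  refine ⟨h x, ?_⟩
  rintro ⟨y, rfl⟩
  exact congrArg (fun f => f.hom y) (X.iCycles_d j k)

theorem isShortExact_iCycles_toCycles {ι : Type*} {c : ComplexShape ι}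
    (X : HomologicalComplex (ModuleCat.{v} A) c) {i j k : ι} (hij : c.Rel i j)
    (hk : c.next j = k) (hX : X.ExactAt j) :
    IsShortExact (X.iCycles i).hom (X.toCycles i j).hom := by
  have hinj : ∀ i, Function.Injective (X.iCycles i) := fun i =>
    (ModuleCat.mono_iff_injective _).1 inferInstance
  have hti : ∀ x, X.iCycles j (X.toCycles i j x) = X.d i j x := fun x =>
    congrArg (fun f => f.hom x) (X.toCycles_i i j)
  refine ⟨hinj i, fun x => ?_, fun z => ?_⟩
  · refine Iff.trans ?_ (range_iCycles X (c.next_eq' hij) x)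
    rw [← hti]
    exact (map_eq_zero_iff (X.iCycles j).hom (hinj j)).symm
  · obtain ⟨y, hy⟩ := (exactAt_iff_forall X (c.prev_eq' hij) hk).1 hX (X.iCycles j z)
      ((range_iCycles X hk _).2 ⟨z, rfl⟩)
    exact ⟨y, hinj j ((hti y).trans hy)⟩

end Complexes

/-! ### Totally acyclic complexes versus the coinductive description -/

section TotallyAcyclic

variable {A : Type v} [Ring A] {M N P Q : ModuleCat.{v} A}

theorem IsTotallyAcyclic.isShortExact {P : CochainComplex (ModuleCat.{v} A) ℤ}
    (hP : IsTotallyAcyclic P) {n m : ℤ} (h : n + 1 = m) :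
    IsShortExact (P.iCycles n).hom (P.toCycles n m).hom :=
  isShortExact_iCycles_toCycles P (by simpa using h) (k := m + 1) (by simp) (hP.acyclic m)

/-- Composing φ with the surjection from the preceding term gives a cocycle of Hom(P, Q), and a
cochain bounding it is the extension. -/
theorem IsTotallyAcyclic.extend {P : CochainComplex (ModuleCat.{v} A) ℤ}
    (hP : IsTotallyAcyclic P) (n : ℤ) (hQ : Projective Q) (φ : P.cycles n ⟶ Q) :
    ∃ ψ : P.X n ⟶ Q, P.iCycles n ≫ ψ = φ := by
  obtain ⟨m, rfl⟩ : ∃ m, n = m + 1 := ⟨n - 1, by simp⟩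
  have hepi : Epi (P.toCycles m (m + 1)) :=
    (ModuleCat.epi_iff_surjective _).2 (hP.isShortExact rfl).surj
  obtain ⟨ψ, hψ⟩ := (homFromComplex_exactAt_iff P Q (i := m - 1) (j := m) (k := m + 1)
    (by simp) (by simp)).1 (hP.hom_acyclic Q hQ m) (P.toCycles m (m + 1) ≫ φ) (by
      rw [← Category.assoc, P.d_toCycles, Limits.zero_comp])
  refine ⟨ψ, ?_⟩
  rw [← cancel_epi (P.toCycles m (m + 1)), ← Category.assoc, P.toCycles_i, hψ]

theorem IsTotallyAcyclic.extProjVanish {P : CochainComplex (ModuleCat.{v} A) ℤ}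
    (hP : IsTotallyAcyclic P) (n : ℤ) : ExtProjVanish (P.cycles n) := by
  intro Q hQ i
  induction i generalizing n with
  | zero =>
    refine (hP.isShortExact (n := n - 1) (by simp)).ext_one_of_extend (hP.projective _) fun φ => ?_
    obtain ⟨ψ, hψ⟩ := hP.extend (n - 1) hQ (ModuleCat.ofHom φ)
    exact ⟨ψ.hom, congrArg ModuleCat.Hom.hom hψ⟩
  | succ i ih =>
    have := hP.projective (n - 1)
    exact SES.ext_third ⟨_, _, hP.isShortExact (n := n - 1) (m := n) (by simp)⟩ Q _ (ih _)
      (Ext.subsingleton_of_projective _ _ _)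

theorem IsGorensteinProjective.hasCoresolution (h : IsGorensteinProjective M) :
    HasCoresolution M := by
  obtain ⟨P, hP, ⟨e⟩⟩ := h
  refine HasCoresolution.congr ?_ e.toLinearEquiv
  refine ⟨fun M => ∃ n, M = P.cycles n, ?_, 0, rfl⟩
  rintro _ ⟨n, rfl⟩
  exact ⟨hP.extProjVanish n, P.X n, P.cycles (n + 1), hP.projective n,
    ⟨_, _, hP.isShortExact rfl⟩, n + 1, rfl⟩

/-- The modules in a bi-infinite chain for a relation without dead ends. -/
theorem exists_int_chain {α : Type*} (p : α → Prop) (r : α → α → Prop)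
    (hr : ∀ a, p a → ∃ b, p b ∧ r a b) (hl : ∀ a, p a → ∃ b, p b ∧ r b a) (a : α) (ha : p a) :
    ∃ Z : ℤ → α, Z 0 = a ∧ (∀ n, p (Z n)) ∧ ∀ n, r (Z n) (Z (n + 1)) := by
  choose f hf hf' using fun x : Subtype p => hr x x.2
  choose g hg hg' using fun x : Subtype p => hl x x.2
  let F : ℕ → Subtype p := fun n => Nat.rec ⟨a, ha⟩ (fun _ x => ⟨f x, hf x⟩) n
  let G : ℕ → Subtype p := fun n => Nat.rec ⟨g ⟨a, ha⟩, hg _⟩ (fun _ x => ⟨g x, hg x⟩) n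
  let Z : ℤ → Subtype p := fun n => match n with
    | .ofNat n => F n
    | .negSucc n => G n
  refine ⟨fun n => Z n, rfl, fun n => (Z n).2, ?_⟩
  rintro (n | _ | n)
  · exact hf' (F n)
  · exact hg' ⟨a, ha⟩
  · exact hg' (G n)

theorem HasCoresolution.exists_ses_left (h : HasCoresolution M) :
    ∃ K P, Projective P ∧ SES K P M ∧ HasCoresolution K :=
  let ⟨K, P, hP, hS⟩ := exists_projective_cover M
  ⟨K, P, hP, hS, .kernel hS hP h⟩

theorem HasCoresolution.isGorensteinProjective (h : HasCoresolution M) :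
    IsGorensteinProjective M := by
  obtain ⟨Z, rfl, hZ, hr⟩ := exists_int_chain HasCoresolution
    (fun X Y => ∃ P, Projective P ∧ SES X P Y)
    (fun X hX => let ⟨P, Y, hP, hS, hY⟩ := hX.exists_ses; ⟨Y, hY, P, hP, hS⟩)
    (fun X hX => let ⟨K, P, hP, hS, hK⟩ := hX.exists_ses_left; ⟨K, hK, P, hP, hS⟩) M h
  choose P hP f g hfg using hr
  have hgf : ∀ n x, g n (f n x) = 0 := fun n x => (hfg n).exact.apply_apply_eq_zero x
  let D : CochainComplex (ModuleCat.{v} A) ℤ := CochainComplex.of P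
    (fun n => ModuleCat.ofHom (f (n + 1) ∘ₗ g n)) (fun n => by
      ext x
      simp [hgf])
  have hd : ∀ n, D.d n (n + 1) = ModuleCat.ofHom (f (n + 1) ∘ₗ g n) := fun n =>
    CochainComplex.of_d P (fun n => ModuleCat.ofHom (f (n + 1) ∘ₗ g n)) n
  have hd0 : ∀ n (x : P n), D.d n (n + 1) x = 0 ↔ ∃ y, f n y = x := fun n x => by
    rw [hd]
    exact (map_eq_zero_iff (f (n + 1)) (hfg (n + 1)).inj).trans ((hfg n).exact x)
  have hex : D.Acyclic := by
    intro n
    obtain ⟨n, rfl⟩ : ∃ m, n = m + 1 := ⟨n - 1, by simp⟩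
    rw [exactAt_iff_forall D (i := n) (k := n + 1 + 1) (by simp) (by simp)]
    intro x hx
    obtain ⟨y, rfl⟩ := (hd0 _ x).1 hx
    obtain ⟨y, rfl⟩ := (hfg n).surj y
    exact ⟨y, by rw [hd]; rfl⟩
  refine ⟨D, ⟨hP, hex, fun Q hQ n => ?_⟩, ?_⟩
  · obtain ⟨n, rfl⟩ : ∃ m, n = m + 1 := ⟨n - 1, by simp⟩
    rw [homFromComplex_exactAt_iff D Q (i := n) (k := n + 1 + 1) (by simp) (by simp)]
    intro φ hφ
    -- A cocycle vanishes on the image of Z (n + 1), so it descends to Z (n + 2). It then extends to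
    -- P (n + 2) because Ext¹(Z (n + 3), Q) = 0.
    have hφf : ∀ x, φ (f (n + 1) x) = 0 := by
      intro x
      obtain ⟨y, rfl⟩ := (hfg n).surj x
      rw [hd] at hφ
      exact congrArg (fun f => f.hom y) hφ
    let e := (g (n + 1)).quotKerEquivOfSurjective (hfg (n + 1)).surj
    have hker : LinearMap.ker (g (n + 1)) ≤ LinearMap.ker φ.hom := by
      intro x hx
      obtain ⟨y, rfl⟩ := ((hfg (n + 1)).exact x).1 hx
      exact hφf y
    let χ : Z (n + 1 + 1) →ₗ[A] Q := (LinearMap.ker (g (n + 1))).liftQ φ.hom hker ∘ₗ e.symm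
    obtain ⟨ψ, hψ⟩ := (hfg (n + 1 + 1)).extend ((hZ _).extProjVanish Q hQ 0) χ
    refine ⟨ModuleCat.ofHom ψ, ?_⟩
    rw [hd]
    ext x
    refine (LinearMap.congr_fun hψ (g (n + 1) x)).trans ?_
    have : e.symm (g (n + 1) x) = (LinearMap.ker (g (n + 1))).mkQ x :=
      e.symm_apply_eq.2 rfl
    change (LinearMap.ker (g (n + 1))).liftQ φ.hom hker (e.symm (g (n + 1) x)) = _
    rw [this]
    rfl
  · have hinj : Function.Injective (D.iCycles 0) :=
      (ModuleCat.mono_iff_injective _).1 inferInstance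
    have hrange : LinearMap.range (D.iCycles 0).hom = LinearMap.range (f 0) := by
      ext x
      exact (range_iCycles D (j := 0) (k := 0 + 1) (by simp) x).symm.trans (hd0 0 x)
    exact ⟨((LinearEquiv.ofInjective _ hinj).trans ((LinearEquiv.ofEq _ _ hrange).trans
      (LinearEquiv.ofInjective _ (hfg 0).inj).symm)).toModuleIso⟩

end TotallyAcyclic

/-! ### GP-extension groups and the hull criterion for the GP-dimension -/

section GPExt

variable {A : Type v} [Ring A] {X Y Z M N : ModuleCat.{v} A}

theorem IsShortExact.desc {f : X →ₗ[A] Y} {g : Y →ₗ[A] Z} (h : IsShortExact f g)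
    (φ : Y →ₗ[A] N) (hφ : φ ∘ₗ f = 0) : ∃ ψ : Z →ₗ[A] N, ψ ∘ₗ g = φ := by
  have hker : LinearMap.ker g ≤ LinearMap.ker φ := by
    intro y hy
    obtain ⟨x, rfl⟩ := (h.exact y).1 hy
    exact LinearMap.congr_fun hφ x
  let e := g.quotKerEquivOfSurjective h.surj
  refine ⟨(LinearMap.ker g).liftQ φ hker ∘ₗ e.symm, ?_⟩
  ext y
  have : e.symm (g y) = (LinearMap.ker g).mkQ y := e.symm_apply_eq.2 rfl
  change (LinearMap.ker g).liftQ φ hker (e.symm (g y)) = φ y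
  rw [this]
  rfl

theorem IsShortExact.extend_of_section {f : X →ₗ[A] Y} {g : Y →ₗ[A] Z} (h : IsShortExact f g)
    {s : Z →ₗ[A] Y} (hs : g ∘ₗ s = LinearMap.id) (φ : X →ₗ[A] N) :
    ∃ ψ : Y →ₗ[A] N, ψ ∘ₗ f = φ := by
  have htfae := (h.exact.split_tfae' (f := f) (g := g)).out 0 1
  obtain ⟨-, r, hr⟩ := htfae.1 ⟨h.inj, s, hs⟩
  exact ⟨φ ∘ₗ r, by rw [LinearMap.comp_assoc, hr, LinearMap.comp_id]⟩

theorem HasHull.congr {fin : Prop} {n : ℕ} (h : HasHull fin n M) (e : M ≃ₗ[A] N) :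
    HasHull fin n N :=
  let ⟨L, C, hS, hLC⟩ := h
  ⟨L, C, hS.congr_left e.symm, hLC⟩

/-- The sequence `0 → Z_{n+1} → X_{n+1} → Z_n → 0` of an acyclic chain complex. -/
theorem isShortExact_cycles {Y : ChainComplex (ModuleCat.{v} A) ℕ} (hY : Y.Acyclic) (n : ℕ) :
    IsShortExact (Y.iCycles (n + 1)).hom (Y.toCycles (n + 1) n).hom :=
  isShortExact_iCycles_toCycles Y (by simp) rfl (hY n)

/-- A map out of `X_{n+1}` which vanishes on boundaries factors through the cycles. -/
theorem exists_desc_cycles {Y : ChainComplex (ModuleCat.{v} A) ℕ} (hY : Y.Acyclic) (n : ℕ)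
    (φ : Y.X (n + 1) ⟶ N) (hφ : Y.d (n + 2) (n + 1) ≫ φ = 0) :
    ∃ ψ : Y.cycles n ⟶ N, Y.toCycles (n + 1) n ≫ ψ = φ := by
  have hepi : Epi (Y.toCycles (n + 2) (n + 1)) :=
    (ModuleCat.epi_iff_surjective _).2 (isShortExact_cycles hY (n + 1)).surj
  have h0 : Y.iCycles (n + 1) ≫ φ = 0 := by
    rw [← cancel_epi (Y.toCycles (n + 2) (n + 1)), ← Category.assoc, Y.toCycles_i, hφ,
      Limits.comp_zero]
  obtain ⟨ψ, hψ⟩ := (isShortExact_cycles hY n).desc φ.hom (congrArg ModuleCat.Hom.hom h0)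
  exact ⟨ModuleCat.ofHom ψ, ModuleCat.hom_ext hψ⟩

theorem exists_extend_cycles_of_section {Y : ChainComplex (ModuleCat.{v} A) ℕ} (hY : Y.Acyclic)
    (n : ℕ) (s : Y.cycles n ⟶ Y.X (n + 1)) (hs : s ≫ Y.toCycles (n + 1) n = 𝟙 _)
    (φ : Y.X (n + 2) ⟶ N) (hφ : Y.d (n + 3) (n + 2) ≫ φ = 0) :
    ∃ ψ : Y.X (n + 1) ⟶ N, Y.d (n + 2) (n + 1) ≫ ψ = φ := by
  obtain ⟨χ, rfl⟩ := exists_desc_cycles hY (n + 1) φ hφ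
  obtain ⟨ψ, hψ⟩ := (isShortExact_cycles hY n).extend_of_section
    (s := s.hom) (congrArg ModuleCat.Hom.hom hs) χ.hom
  have : Y.iCycles (n + 1) ≫ ModuleCat.ofHom ψ = χ := ModuleCat.hom_ext hψ
  exact ⟨ModuleCat.ofHom ψ, by rw [← this, ← Category.assoc, Y.toCycles_i]⟩

theorem homToComplex_exactAt_of_ext {Y : ChainComplex (ModuleCat.{v} A) ℕ} (hY : Y.Acyclic)
    (n : ℕ) (hN : Subsingleton (Ext N (Y.cycles (n + 1)) 1)) : (homToComplex N Y).ExactAt n := by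
  rw [homToComplex_exactAt_iff Y N (i := n + 1) (by simp) rfl]
  intro φ hφ
  obtain ⟨ψ, hψ⟩ := (isShortExact_cycles hY n).lift hN (Y.liftCycles φ _ rfl hφ).hom
  have : ModuleCat.ofHom ψ ≫ Y.toCycles (n + 1) n = Y.liftCycles φ _ rfl hφ :=
    ModuleCat.hom_ext hψ
  exact ⟨ModuleCat.ofHom ψ, by
    rw [← Y.toCycles_i, ← Category.assoc, this, Y.liftCycles_i]⟩

/-- The cycles in degree zero of a chain complex. -/
noncomputable def cyclesZeroIso (Y : ChainComplex (ModuleCat.{v} A) ℕ) : Y.cycles 0 ≅ Y.X 0 :=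
  Y.iCyclesIso 0 0 (by simp) (Y.shape _ _ (by simp))

/-- A bound that does not improve with n suffices: finiteness alone makes Ext from
Gorenstein-projective modules into the syzygies vanish. -/
theorem hasProjectiveDimensionLE_cycles {Y : ChainComplex (ModuleCat.{v} A) ℕ} (hY : Y.Acyclic)
    (hproj : ∀ n, Projective (Y.X (n + 1))) {d : ℕ} (h : HasProjectiveDimensionLE (Y.X 0) d)
    (n : ℕ) : HasProjectiveDimensionLE (Y.cycles n) d := by
  induction n with
  | zero => exact hasProjectiveDimensionLT_of_iso (cyclesZeroIso Y).symm (d + 1)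
  | succ n ih =>
    have := hproj n
    exact SES.hasProjectiveDimensionLT_first ⟨_, _, isShortExact_cycles hY n⟩ (d + 1)
      (hasProjectiveDimensionLT_of_ge _ 1 _ (by lia))
      (hasProjectiveDimensionLT_of_ge _ (d + 1) _ (by lia))

namespace ProperGPResolution

variable (G : ProperGPResolution M)

/-- The augmented complex of a proper Gorenstein-projective resolution. -/
noncomputable def augmented : ChainComplex (ModuleCat.{v} A) ℕ :=
  G.complex.augment G.aug G.d_aug

/-- The zeroth syzygy is the resolved module. -/
noncomputable def cyclesZeroIso : G.augmented.cycles 0 ≅ M :=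
  Gorenstein.cyclesZeroIso G.augmented

theorem hasCoresolution (n : ℕ) : HasCoresolution (G.augmented.X (n + 1)) :=
  (G.gorensteinProjective n).hasCoresolution

theorem ses_cycles (n : ℕ) :
    SES (G.augmented.cycles (n + 1)) (G.augmented.X (n + 1)) (G.augmented.cycles n) :=
  ⟨_, _, isShortExact_cycles G.acyclic n⟩

theorem lift_cycles (hN : HasCoresolution N) (n : ℕ) (φ : N ⟶ G.augmented.cycles n) :
    ∃ ψ : N ⟶ G.augmented.X (n + 1), ψ ≫ G.augmented.toCycles (n + 1) n = φ := by
  obtain ⟨ψ, hψ⟩ := (homToComplex_exactAt_iff G.augmented N (i := n + 1) (by simp) rfl).1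
    (G.proper N hN.isGorensteinProjective n) (φ ≫ G.augmented.iCycles n) (by simp)
  refine ⟨ψ, ?_⟩
  rw [← cancel_mono (G.augmented.iCycles n), Category.assoc, HomologicalComplex.toCycles_i, hψ]

theorem hasHull_cycles {fin : Prop} {m : ℕ} (h : HasHull fin m M) (n : ℕ) :
    HasHull False (m - n) (G.augmented.cycles n) := by
  induction n with
  | zero =>
    obtain ⟨L, C, hS, hL, hC, -⟩ := h.congr G.cyclesZeroIso.symm.toLinearEquiv
    exact ⟨L, C, hS, hL, hC, False.elim⟩
  | succ n ih =>
    -- Subtraction is truncated: once n ≥ m the bound stays 0, so `mono` is needed before the next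
    -- syzygy.
    exact (ih.mono (n := m - (n + 1) + 1) (by lia)).syzygy (G.ses_cycles n) (G.hasCoresolution n)

theorem hasHull_of_cycles {m : ℕ} (n : ℕ) (h : HasHull False m (G.augmented.cycles n)) :
    HasHull False (m + n) M := by
  induction n generalizing m with
  | zero => exact h.congr G.cyclesZeroIso.toLinearEquiv
  | succ n ih =>
    refine (ih (m := m + 1) ?_).mono (by lia)
    exact HasHull.of_syzygy h (G.ses_cycles n) (G.hasCoresolution n) (fun W hW _ => hW.hasHull)
      False.elim

theorem subsingleton_gpExt_iff (n : ℕ) :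
    Subsingleton (gpExt G N n) ↔ (homFromComplex G.complex N).ExactAt n := by
  rw [HomologicalComplex.exactAt_iff_isZero_homology]
  exact ⟨fun h => @AddCommGrpCat.isZero_of_subsingleton _ h,
    fun h => AddCommGrpCat.subsingleton_of_isZero h⟩

theorem subsingleton_gpExt_succ_iff (n : ℕ) :
    Subsingleton (gpExt G N (n + 1)) ↔ ∀ φ : G.augmented.X (n + 2) ⟶ N,
      G.augmented.d (n + 3) (n + 2) ≫ φ = 0 →
        ∃ ψ : G.augmented.X (n + 1) ⟶ N, G.augmented.d (n + 2) (n + 1) ≫ ψ = φ := by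
  rw [G.subsingleton_gpExt_iff, homFromComplex_exactAt_iff G.complex N (i := n + 2) (k := n)
    (by simp) (by simp)]
  rfl

/-- From step m on, the syzygies are Gorenstein-projective, so properness lifts their identity maps
and the resolution splits there. -/
theorem subsingleton_gpExt_of_hasHull {fin : Prop} {m : ℕ} (h : HasHull fin m M) {n : ℕ}
    (hn : m < n) : Subsingleton (gpExt G N n) := by
  obtain ⟨n, rfl⟩ : ∃ k, n = k + 1 := ⟨n - 1, by lia⟩
  rw [G.subsingleton_gpExt_succ_iff]
  intro φ hφ
  have hK : HasCoresolution (G.augmented.cycles n) :=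
    ((G.hasHull_cycles h n).mono (n := 0) (by lia)).hasCoresolution
  obtain ⟨s, hs⟩ := G.lift_cycles hK n (𝟙 _)
  exact exists_extend_cycles_of_section G.acyclic n s hs φ hφ

theorem subsingleton_gpExt_zero [Subsingleton M] : Subsingleton (gpExt G N 0) := by
  rw [G.subsingleton_gpExt_iff, homFromComplex_exactAt_iff G.complex N (i := 1) (k := 0)
    (by simp) (by simp)]
  intro φ hφ
  obtain ⟨χ, hχ⟩ := exists_desc_cycles (Y := G.augmented) G.acyclic 0 φ hφ
  have := G.cyclesZeroIso.toLinearEquiv.subsingleton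
  have h0 : χ = 0 := by
    ext x
    rw [Subsingleton.elim x 0, map_zero, map_zero]
  refine ⟨0, ?_⟩
  rw [Limits.comp_zero, ← hχ, h0]
  exact Limits.comp_zero.symm

/-- The augmentation is a degree-zero cocycle with values in M. There are no nonzero coboundaries in
degree 0, so it vanishes; yet it is surjective. -/
theorem subsingleton_of_gpExt_zero (h : Subsingleton (gpExt G M 0)) : Subsingleton M := by
  rw [G.subsingleton_gpExt_iff, homFromComplex_exactAt_iff G.complex M (i := 1) (k := 0)
    (by simp) (by simp)] at h
  obtain ⟨ψ, hψ⟩ := h G.aug G.d_aug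
  rw [G.complex.shape 0 0 (by simp), Limits.zero_comp] at hψ
  refine subsingleton_of_forall_eq 0 fun x => ?_
  obtain ⟨y, rfl⟩ := (exactAt_iff_forall G.augmented (i := 1) (by simp) rfl).1 (G.acyclic 0) x
    (by rw [G.augmented.shape _ _ (by simp)]; rfl)
  exact (congrArg (fun f => f.hom y) hψ).symm

/-- The surjection onto the syzygy Z_{n+1} is a universal cocycle. Being a coboundary, it yields a
retraction of Z_{n+1} → X_{n+1}, so Z_n is a summand of a Gorenstein-projective module. -/
theorem hasCoresolution_cycles (n : ℕ)
    (h : Subsingleton (gpExt G (G.augmented.cycles (n + 1)) (n + 1))) :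
    HasCoresolution (G.augmented.cycles n) := by
  rw [G.subsingleton_gpExt_succ_iff] at h
  obtain ⟨ψ, hψ⟩ := h (G.augmented.toCycles (n + 2) (n + 1)) (G.augmented.d_toCycles _ _ _)
  have hepi : Epi (G.augmented.toCycles (n + 2) (n + 1)) :=
    (ModuleCat.epi_iff_surjective _).2 (isShortExact_cycles G.acyclic (n + 1)).surj
  have hr : G.augmented.iCycles (n + 1) ≫ ψ = 𝟙 _ := by
    rw [← cancel_epi (G.augmented.toCycles (n + 2) (n + 1)), ← Category.assoc,
      HomologicalComplex.toCycles_i, hψ, Category.comp_id]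
  obtain ⟨e⟩ := (isShortExact_cycles G.acyclic n).equiv_prod_of_retraction (r := ψ.hom)
    (congrArg ModuleCat.Hom.hom hr)
  exact ((G.hasCoresolution n).congr (N := ModuleCat.of A (_ × _))
    (e.trans (LinearEquiv.prodComm A _ _))).of_prod

end ProperGPResolution

theorem gpDim_le_iff (M : ModuleCat.{v} A) (m : ℕ) :
    gpDim M ≤ m ↔ ∀ (G : ProperGPResolution M) (N : ModuleCat.{v} A) (n : ℕ), m < n →
      Subsingleton (gpExt G N n) := by
  rw [gpDim, sSup_le_iff]
  constructor
  · intro h G N n hn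
    rw [← not_nontrivial_iff_subsingleton]
    intro hnt
    have := h n ⟨n, rfl, G, N, hnt⟩
    rw [Nat.cast_le] at this
    lia
  · rintro h _ ⟨n, rfl, G, N, hnt⟩
    rw [Nat.cast_le]
    by_contra! hn
    exact not_nontrivial_iff_subsingleton.2 (h G N n hn) hnt

theorem HasHull.gpDim_le {fin : Prop} {m : ℕ} (h : HasHull fin m M) : gpDim M ≤ m :=
  (gpDim_le_iff M m).2 fun G _ _ hn => G.subsingleton_gpExt_of_hasHull h hn

theorem ProperGPResolution.hasHull (G : ProperGPResolution M) {m : ℕ} (h : gpDim M ≤ m) :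
    HasHull False m M := by
  rw [gpDim_le_iff] at h
  have := G.hasHull_of_cycles m (G.hasCoresolution_cycles m (h G _ _ (by lia))).hasHull
  rwa [zero_add] at this

theorem gpDim_eq_bot_of_subsingleton [Subsingleton M] : gpDim M = ⊥ := by
  rw [gpDim, sSup_eq_bot]
  rintro _ ⟨n, rfl, G, N, hnt⟩
  refine (not_nontrivial_iff_subsingleton.2 ?_ hnt).elim
  rcases n with _ | n
  · exact G.subsingleton_gpExt_zero
  · exact G.subsingleton_gpExt_of_hasHull (hasHull_of_hasProjectiveDimensionLE 0
      ((projective_iff_hasProjectiveDimensionLE_zero _).1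
        (ModuleCat.isZero_of_subsingleton M).projective)) (by lia)

theorem ProperGPResolution.subsingleton_of_gpDim_eq_bot (G : ProperGPResolution M)
    (h : gpDim M = ⊥) : Subsingleton M := by
  refine G.subsingleton_of_gpExt_zero ?_
  rw [← not_nontrivial_iff_subsingleton]
  intro hnt
  have : ((0 : ℕ) : WithBot ℕ∞) ≤ ⊥ := h ▸ le_sSup ⟨0, rfl, G, M, hnt⟩
  simp at this

/-- If the Gorenstein-projective dimension is not `⊥`, then there is a resolution. -/
theorem nonempty_properGPResolution (h : gpDim M ≠ ⊥) : Nonempty (ProperGPResolution M) := by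
  by_contra hM
  refine h ?_
  rw [gpDim, sSup_eq_bot]
  rintro _ ⟨n, rfl, G, -⟩
  exact (hM ⟨G⟩).elim

/-- A projective resolution of a module of finite projective dimension is a proper
Gorenstein-projective resolution. -/
theorem nonempty_properGPResolution_of_hasProjectiveDimensionLE {d : ℕ}
    (h : HasProjectiveDimensionLE M d) : Nonempty (ProperGPResolution M) := by
  let P := ProjectiveResolution.of M
  let aug : P.complex.X 0 ⟶ M := P.π.f 0
  have hw : P.complex.d 1 0 ≫ aug = 0 := P.complex_d_comp_π_f_zero
  let Y : ChainComplex (ModuleCat.{v} A) ℕ := P.complex.augment aug hw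
  have hepi : Epi aug := inferInstanceAs (Epi (P.π.f 0))
  have hY : Y.Acyclic := by
    rintro (_ | _ | n)
    · rw [exactAt_iff_forall Y (i := 1) (by simp) rfl]
      intro x _
      exact (ModuleCat.epi_iff_surjective aug).1 hepi x
    · rw [exactAt_iff_forall Y (i := 2) (k := 0) (by simp) (by simp)]
      exact (ShortComplex.moduleCat_exact_iff _).1
        (ShortComplex.exact_of_g_is_cokernel (ShortComplex.mk _ _ hw) P.isColimitCokernelCofork)
    · rw [exactAt_iff_forall Y (i := n + 3) (k := n + 1) (by simp) (by simp)]
      exact (ShortComplex.moduleCat_exact_iff _).1 (P.exact_succ n)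
  have hproj : ∀ n, Projective (Y.X (n + 1)) := P.projective
  refine ⟨⟨P.complex, aug, hw, fun n => (HasCoresolution.of_projective
    (P.projective n)).isGorensteinProjective, hY, fun G hG n => ?_⟩⟩
  exact homToComplex_exactAt_of_ext hY n
    (hG.hasCoresolution.extProjVanish.ext_subsingleton d
      (hasProjectiveDimensionLE_cycles hY hproj h (n + 1)) 0)

end GPExt

/-! ### Comparison of the two dimensions -/

section Main

variable {A : Type v} [Ring A] {M : ModuleCat.{v} A}

theorem eq_bot_or_natCast_of_lt_top {d : WithBot ℕ∞} (hd : d < ⊤) :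
    d = ⊥ ∨ ∃ n : ℕ, d = n := by
  induction d with
  | bot => exact .inl rfl
  | coe d =>
    induction d with
    | top => exact (lt_irrefl _ hd).elim
    | coe d => exact .inr ⟨d, rfl⟩

/-- Natural upper bounds do not distinguish ⊥ from 0, hence the separate condition on ⊥. -/
theorem eq_of_forall_le_natCast_iff {a b : WithBot ℕ∞} (h : ∀ m : ℕ, a ≤ m ↔ b ≤ m)
    (hbot : a = ⊥ ↔ b = ⊥) : a = b := by
  by_cases ha : a < ⊤
  · rcases eq_bot_or_natCast_of_lt_top ha with rfl | ⟨n, rfl⟩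
    · exact (hbot.1 rfl).symm
    · have hb : b ≤ n := (h n).1 le_rfl
      rcases eq_bot_or_natCast_of_lt_top (hb.trans_lt ha) with rfl | ⟨m, rfl⟩
      · exact hbot.2 rfl
      · exact le_antisymm ((h m).2 le_rfl) hb
  · by_cases hb : b < ⊤
    · rcases eq_bot_or_natCast_of_lt_top hb with rfl | ⟨n, rfl⟩
      · exact hbot.2 rfl
      · exact (ha (((h n).2 le_rfl).trans_lt hb)).elim
    · rw [not_lt_top_iff] at ha hb
      rw [ha, hb]

theorem projectiveDimension_eq_bot_iff_subsingleton :
    projectiveDimension M = ⊥ ↔ Subsingleton M := by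
  rw [projectiveDimension_eq_bot_iff]
  exact ⟨fun h => ModuleCat.subsingleton_of_isZero h,
    fun h => @ModuleCat.isZero_of_subsingleton _ _ _ h⟩

/-- A module whose projective dimension is finite has the same Gorenstein-projective dimension. -/
theorem gpDim_eq_projectiveDimension (h : projectiveDimension M < ⊤) :
    gpDim M = projectiveDimension M := by
  obtain ⟨d, hd⟩ := (projectiveDimension_ne_top_iff M).1 h.ne
  obtain ⟨G⟩ := nonempty_properGPResolution_of_hasProjectiveDimensionLE hd
  refine eq_of_forall_le_natCast_iff (fun m => ?_) ?_
  · rw [projectiveDimension_le_iff]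
    exact ⟨fun hm => (G.hasHull hm).hasProjectiveDimensionLE hd,
      fun hm => (hasHull_of_hasProjectiveDimensionLE m hm).gpDim_le⟩
  · rw [projectiveDimension_eq_bot_iff_subsingleton]
    exact ⟨G.subsingleton_of_gpDim_eq_bot, fun _ => gpDim_eq_bot_of_subsingleton⟩

/-- The witness is the hull of M. The proposition `fin` serves both the large and the small
dimension. -/
theorem exists_projectiveDimension_eq_gpDim {n : ℕ} (hn : gpDim M = n) {fin : Prop}
    (hfin : HasHull False n M → HasHull fin n M) :
    ∃ L : ModuleCat.{v} A, projectiveDimension L = n ∧ (fin → Module.Finite A L) := by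
  obtain ⟨G⟩ := nonempty_properGPResolution (M := M) (by rw [hn]; exact WithBot.coe_ne_bot)
  obtain ⟨L, C, hS, hL, hC, hf⟩ := hfin (G.hasHull hn.le)
  refine ⟨L, le_antisymm ((projectiveDimension_le_iff L n).2 hL) ?_, hf⟩
  by_contra! hlt
  have hlt' := (projectiveDimension_lt_iff (X := L) (n := n)).1 hlt
  -- For n = 0 a smaller dimension means L = 0, so M = 0 and its GP-dimension is ⊥. Otherwise L is a
  -- hull of smaller dimension and bounds that of M.
  rcases n with _ | n
  · obtain ⟨f, hf⟩ := hS.exists_injective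
    have := ModuleCat.subsingleton_of_isZero ((hasProjectiveDimensionLT_zero_iff_isZero _).1 hlt')
    have := hf.subsingleton
    rw [gpDim_eq_bot_of_subsingleton] at hn
    exact WithBot.bot_ne_coe hn
  · have : HasHull False n M := ⟨L, C, hS, hlt', hC, False.elim⟩
    have := hn ▸ this.gpDim_le
    rw [Nat.cast_le] at this
    lia

end Main

end Gorenstein

theorem mainTheorem6 (R : Type u) [CommRing R] [IsArtinianRing R]
    (A : Type v) [Ring A] [Algebra R A] [Module.Finite R A] :
    Gorenstein.bigFinDim A = Gorenstein.bigFinGPDim A ∧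
      Gorenstein.smallFinDim A = Gorenstein.smallFinGPDim A := by
  refine ⟨le_antisymm ?_ ?_, le_antisymm ?_ ?_⟩
  · refine iSup₂_le fun M hM => ?_
    have h := Gorenstein.gpDim_eq_projectiveDimension hM
    rw [← h] at hM ⊢
    exact le_iSup₂_of_le M hM le_rfl
  · refine iSup₂_le fun M hM => ?_
    rcases Gorenstein.eq_bot_or_natCast_of_lt_top hM with h | ⟨n, hn⟩
    · simp [h]
    · obtain ⟨L, hL, -⟩ :=
        Gorenstein.exists_projectiveDimension_eq_gpDim hn id
      rw [hn] at hM ⊢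
      rw [← hL] at hM ⊢
      exact le_iSup₂_of_le L hM le_rfl
  · refine iSup_le fun M => iSup₂_le fun hf hM => ?_
    have h := Gorenstein.gpDim_eq_projectiveDimension hM
    rw [← h] at hM ⊢
    exact le_iSup_of_le M (le_iSup₂_of_le hf hM le_rfl)
  · refine iSup_le fun M => iSup₂_le fun hf hM => ?_
    rcases Gorenstein.eq_bot_or_natCast_of_lt_top hM with h | ⟨n, hn⟩
    · simp [h]
    · obtain ⟨L, hL, hLf⟩ :=
        Gorenstein.exists_projectiveDimension_eq_gpDim hn (fun h => h.finite R)
      rw [hn] at hM ⊢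
      rw [← hL] at hM ⊢
      exact le_iSup_of_le L (le_iSup₂_of_le (hLf trivial) hM le_rfl)
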